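/- Let $n\ge 1$, let $\Omega\subset\mathbb R^n$ be a bounded domain with $C^2$ boundary, and let $M(t)=t$ for $t\ge 0$. Consider the heat equation with memory $$\partial_t y-\Delta y+\int_0^t M(t-s)\,y(s,x)\,ds=0\ \text{ in }(0,\infty)\times\Omega,\qquad y=0\ \text{ on }(0,\infty)\times\partial\Omega,\qquad y(0,\cdot)=y_0\in L^2(\Omega),$$ whose solutions $y(\cdot;y_0)\in C([0,\infty);L^2(\Omega))$ are understood in the weak (equivalently, mild) sense. The equation has the backward uniqueness at $\{t_0\}$, $t_0>0$, if for every $y_0\in L^2(\Omega)$, $y(t_0;y_0)=0$ implies $y_0=0$. Let $A$ be the Dirichlet Laplacian on $L^2(\Omega)$, with domain $H^2(\Omega)\cap H^1_0(\Omega)$. Its negative $-A$ has a nonempty countable set of eigenvalues; let $(\lambda_k)_{k\ge1}$ be an enumeration of it (repetitions allowed). For $k\ge 1$ let $x_k$ be the solution of $$x'(t)+\lambda_k x(t)+\int_0^t M(t-s)\,x(s)\,ds=0\ (t>0),\qquad x(0)=1,$$ and let $\mathcal N_k=\{t>0: x_k(t)=0\}$. Then: 1. for each $k$ there are real numbers $\alpha_k<0$,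 $C_k$, $\beta_k$, $\varphi_k$ such that $\mathcal N_k=\{t>0: e^{\alpha_k t}=C_k\sin(\beta_k t+\varphi_k)\}$; 2. the set $\bigcup_{k\ge1}\mathcal N_k$ is countable; 3. for every $t_0\in(0,\infty)\setminus\bigcup_{k\ge1}\mathcal N_k$, the equation has the backward uniqueness at $\{t_0\}$. -/

import Mathlib

open MeasureTheory Set
open scoped ContDiff

namespace HeatMemory

/-- `ℝⁿ` with its Euclidean norm. -/
abbrev Space (n : ℕ) : Type := EuclideanSpace ℝ (Fin n)

/-- A bounded domain (nonempty connected open set) with `C²` boundary: near each boundary point,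
`Ω` is the set where a `C²` function with nonvanishing differential is negative. -/
structure IsBoundedC2Domain {n : ℕ} (Ω : Set (Space n)) : Prop where
  isOpen : IsOpen Ω
  isConnected : IsConnected Ω
  isBounded : Bornology.IsBounded Ω
  boundary : ∀ x ∈ frontier Ω, ∃ (U : Set (Space n)) (ρ : Space n → ℝ),
    IsOpen U ∧ x ∈ U ∧ ContDiffOn ℝ 2 ρ U ∧ fderiv ℝ ρ x ≠ 0 ∧ ∀ z ∈ U, z ∈ Ω ↔ ρ z < 0

/-- The real Hilbert space `L²(Ω)`. -/
abbrev L2 {n : ℕ} (Ω : Set (Space n)) : Type := Lp ℝ 2 (volume.restrict Ω)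

/-- The Hilbert space `L²(Ω; ℝⁿ)` of square integrable vector fields. -/
abbrev L2Field {n : ℕ} (Ω : Set (Space n)) : Type := Lp (Space n) 2 (volume.restrict Ω)

/-- The pairs `(φ, ∇φ)` with `φ ∈ C_c^∞(Ω)`. -/
def testGraph {n : ℕ} (Ω : Set (Space n)) : Set (L2 Ω × L2Field Ω) :=
  {p | ∃ φ : Space n → ℝ, ContDiff ℝ ∞ φ ∧ HasCompactSupport φ ∧ tsupport φ ⊆ Ω ∧
    p.1 =ᵐ[volume.restrict Ω] φ ∧ p.2 =ᵐ[volume.restrict Ω] gradient φ}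

/-- The space `H¹₀(Ω)`, the closure of `C_c^∞(Ω)` for the `H¹` norm. It is realised as a space of
pairs `(u, ∇u)`, where `∇u` is the weak gradient of `u` (which `u` determines). -/
def H10 {n : ℕ} (Ω : Set (Space n)) : Set (L2 Ω × L2Field Ω) := closure (testGraph Ω)

/-- The Dirichlet Laplacian `A` as a graph: `u ∈ D(A)` and `A u = f`. That is, `u ∈ H¹₀(Ω)`,
`f ∈ L²(Ω)` and `∫_Ω ∇u · ∇v = - ∫_Ω f v` for all `v ∈ H¹₀(Ω)`. For a bounded domain with `C²`
boundary, `D(A) = H²(Ω) ∩ H¹₀(Ω)` and `A u = Δ u`. -/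
def IsDirichletLaplacian {n : ℕ} (Ω : Set (Space n)) (u f : L2 Ω) : Prop :=
  ∃ G : L2Field Ω, (u, G) ∈ H10 Ω ∧ ∀ p ∈ H10 Ω, inner ℝ G p.2 = - inner ℝ f p.1

/-- The eigenvalues of `-A`. -/
def eigenvalues {n : ℕ} (Ω : Set (Space n)) : Set ℝ :=
  {μ | ∃ e : L2 Ω, e ≠ 0 ∧ IsDirichletLaplacian Ω e (-(μ • e))}

/-- `lam` enumerates the eigenvalues of `-A`. Repetitions are allowed, so that the enumeration with
multiplicities is included. -/
def IsEigenvalueSequence {n : ℕ} (Ω : Set (Space n)) (lam : ℕ → ℝ) : Prop :=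
  range lam = eigenvalues Ω

/-- `y ∈ C([0,∞); L²(Ω))` solves `∂ₜ y - Δ y + ∫₀ᵗ M(t-s) y(s) ds = 0`, `y = 0` on `∂Ω`,
`y(0) = y₀`. The equation is tested against every `φ ∈ D(A)`, as usual for solutions in
`C([0,∞); L²(Ω))`; the boundary condition is carried by the use of all of `D(A)`. -/
structure IsSolution {n : ℕ} (Ω : Set (Space n)) (M : ℝ → ℝ) (y₀ : L2 Ω) (y : ℝ → L2 Ω) :
    Prop where
  continuousOn : ContinuousOn y (Ici 0)
  initial : y 0 = y₀
  equation : ∀ φ f : L2 Ω, IsDirichletLaplacian Ω φ f → ∀ t : ℝ, 0 < t →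
    HasDerivAt (fun s => inner ℝ (y s) φ)
      (inner ℝ (y t) f - inner ℝ (∫ s in (0 : ℝ)..t, M (t - s) • y s) φ) t

/-- Backward uniqueness at a finite set `T` of times: a solution that vanishes at all
the times in `T` has zero initial datum. -/
def BackwardUniquenessAt {n : ℕ} (Ω : Set (Space n)) (M : ℝ → ℝ) (T : Finset ℝ) : Prop :=
  ∀ (y₀ : L2 Ω) (y : ℝ → L2 Ω), IsSolution Ω M y₀ y → (∀ t ∈ T, y t = 0) → y₀ = 0

/-- `x` solves `x'(t) + μ x(t) + ∫₀ᵗ M(t-s) x(s) ds = 0` for `t > 0`, with `x(0) = 1`. -/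
structure IsModeSolution (M : ℝ → ℝ) (μ : ℝ) (x : ℝ → ℝ) : Prop where
  continuousOn : ContinuousOn x (Ici 0)
  initial : x 0 = 1
  equation : ∀ t : ℝ, 0 < t →
    HasDerivAt x (-(μ * x t) - ∫ s in (0 : ℝ)..t, M (t - s) * x s) t

/-- The positive zeros of the (unique) solution of the mode equation with parameter `μ`. -/
def zeroSet (M : ℝ → ℝ) (μ : ℝ) : Set ℝ :=
  {t | 0 < t ∧ ∃ x : ℝ → ℝ, IsModeSolution M μ x ∧ x t = 0}

end HeatMemory

/-!
Projecting the equation on an eigenvector `e` of `-A` with eigenvalue `μ` shows that `⟪y(t), e⟫`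
is a multiple of the mode `x` with parameter `μ`. If `y(t₀) = 0` and `t₀` is not a zero of any
mode, then `⟪y₀, e⟫ = 0` for every eigenvector `e` (`IsSolution.inner_initial_eq_zero`), and
`y₀ = 0` because the eigenvectors span a dense subspace
(`eq_zero_of_forall_inner_eigenvector_eq_zero`).

Completeness of the eigenvectors is the spectral theorem for the compact self-adjoint operator
`(1 - A)⁻¹ = J J*`, where `J : H¹₀(Ω) → L²(Ω)` is the embedding. It is injective because test
functions are dense in `L²(Ω)`. Its compactness is Rellich's theorem (`isCompactOperator_embed`):
convolution with a normalized bump of radius `ε` differs from the identity by at most `ε ‖∇φ‖`, and it is a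
compact operator because its kernel is an `L²(Ω)`-valued `L²` function, hence a limit of simple
functions, which define operators of finite rank (`isCompactOperator_kernelOp`). The eigenvalues
are nonnegative, and they are countable because `L²(Ω)` is separable.

For `μ ≥ 0` the mode is `x = u''` with `u''' + μ u'' + u = 0`. The characteristic polynomial
`s³ + μ s² + 1` has one real root `r < 0` and a pair `a ± i b` with `a > 0`, so `x(t) = 0` amounts
to `e^{(r - a) t} = C sin (b t + φ)` (`zeroSet_eq`). Both sides are analytic and they do not
coincide, since only the right-hand side is bounded as `t → -∞`; so the zeros are countable
(`countable_setOf_exp_eq_sin`).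
-/

namespace HeatMemory

/-! ### The mode equation -/

/-- Repeated integration by parts: `∫₀ᵗ (t - s) f''(s) ds = f(t)` when `f(0) = f'(0) = 0`. -/
lemma integral_sub_mul_eq {f f' f'' : ℝ → ℝ} (hf : ∀ t, HasDerivAt f (f' t) t)
    (hf' : ∀ t, HasDerivAt f' (f'' t) t) (hf'' : Continuous f'') (h0 : f 0 = 0) (h0' : f' 0 = 0)
    (t : ℝ) : ∫ s in (0 : ℝ)..t, (t - s) * f'' s = f t := by
  have h : ∀ s ∈ uIcc 0 t, HasDerivAt (fun s => (t - s) * f' s + f s) ((t - s) * f'' s) s := by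
    intro s _
    have := (((hasDerivAt_id s).const_sub t).mul (hf' s)).add (hf s)
    refine this.congr_deriv ?_
    simp
  rw [intervalIntegral.integral_eq_sub_of_hasDerivAt h
    (Continuous.intervalIntegrable (by fun_prop) _ _)]
  simp [h0, h0']

/-- Energy argument: with `V = ∫₀ᵗ w` and `U = ∫₀ᵗ V`, the function `e^{-2t} (w² + V² + U²)` is
nonincreasing on `[0, ∞)`. -/
lemma eq_zero_of_memory_equation {μ : ℝ} (hμ : 0 ≤ μ) {w : ℝ → ℝ} (hw : ContinuousOn w (Ici 0))
    (hw0 : w 0 = 0)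
    (hw' : ∀ t, 0 < t → HasDerivAt w (-(μ * w t) - ∫ s in (0 : ℝ)..t, (t - s) * w s) t)
    {t : ℝ} (ht : 0 ≤ t) : w t = 0 := by
  -- A continuous extension of `w` to the whole line makes the primitives differentiable everywhere.
  let g : ℝ → ℝ := fun s => w (max s 0)
  have hg : Continuous g := by
    rw [← continuousOn_univ]
    exact hw.comp (by fun_prop) (fun s _ => le_max_right s 0)
  have hgw : ∀ s, 0 ≤ s → g s = w s := fun s hs => by simp [g, hs]
  let V : ℝ → ℝ := fun t => ∫ s in (0 : ℝ)..t, g s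
  have hV : ∀ t, HasDerivAt V (g t) t := fun t => hg.integral_hasStrictDerivAt 0 t |>.hasDerivAt
  have hVc : Continuous V := continuous_iff_continuousAt.2 fun t => (hV t).continuousAt
  let U : ℝ → ℝ := fun t => ∫ s in (0 : ℝ)..t, V s
  have hU : ∀ t, HasDerivAt U (V t) t := fun t => hVc.integral_hasStrictDerivAt 0 t |>.hasDerivAt
  have hUc : Continuous U := continuous_iff_continuousAt.2 fun t => (hU t).continuousAt
  have hI : ∀ t, 0 < t → ∫ s in (0 : ℝ)..t, (t - s) * w s = U t := by
    intro t ht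
    rw [← integral_sub_mul_eq hU hV hg (by simp [U]) (by simp [V]) t]
    refine intervalIntegral.integral_congr fun s hs => ?_
    rw [uIcc_of_le ht.le] at hs
    simp only [hgw s hs.1]
  let E : ℝ → ℝ := fun t => Real.exp (-2 * t) * (w t ^ 2 + V t ^ 2 + U t ^ 2)
  have hEd : ∀ t, 0 < t → HasDerivAt E (Real.exp (-2 * t) * (-2) * (w t ^ 2 + V t ^ 2 + U t ^ 2) +
      Real.exp (-2 * t) * (2 * w t * (-(μ * w t) - U t) + 2 * V t * w t + 2 * U t * V t)) t := by
    intro t ht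
    have h1 := hw' t ht
    rw [hI t ht] at h1
    have h2 := hV t
    rw [hgw t ht.le] at h2
    have h3 : HasDerivAt (fun t : ℝ => Real.exp (-2 * t)) (Real.exp (-2 * t) * (-2)) t := by
      simpa using ((hasDerivAt_id t).const_mul (-2 : ℝ)).exp
    refine (h3.mul (((h1.pow 2).add (h2.pow 2)).add ((hU t).pow 2))).congr_deriv ?_
    simp
  have hE : AntitoneOn E (Ici 0) := by
    refine antitoneOn_of_deriv_nonpos (convex_Ici 0) ?_ ?_ ?_
    · refine ContinuousOn.mul (by fun_prop) (ContinuousOn.add (ContinuousOn.add (hw.pow 2) ?_) ?_)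
        <;> fun_prop
    · intro t ht
      rw [interior_Ici] at ht
      exact (hEd t ht).differentiableAt.differentiableWithinAt
    · intro t ht
      rw [interior_Ici] at ht
      rw [(hEd t ht).deriv, mul_assoc, ← mul_add]
      refine mul_nonpos_of_nonneg_of_nonpos (Real.exp_pos _).le ?_
      nlinarith [sq_nonneg (w t + U t), sq_nonneg (w t - V t), sq_nonneg (U t - V t),
        mul_nonneg hμ (sq_nonneg (w t))]
  have h0 : E t ≤ 0 := by
    have := hE (mem_Ici.2 le_rfl) (mem_Ici.2 ht) ht
    simpa [E, hw0, V, U] using this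
  have h1 : w t ^ 2 + V t ^ 2 + U t ^ 2 ≤ 0 := by
    by_contra! h
    exact absurd h0 (not_le.2 (mul_pos (Real.exp_pos _) h))
  nlinarith [sq_nonneg (w t), sq_nonneg (V t), sq_nonneg (U t)]

lemma intervalIntegrable_sub_mul {x : ℝ → ℝ} (hx : ContinuousOn x (Ici 0)) {t : ℝ} (ht : 0 < t) :
    IntervalIntegrable (fun s => (t - s) * x s) volume 0 t := by
  refine ContinuousOn.intervalIntegrable ?_
  rw [uIcc_of_le ht.le]
  exact ContinuousOn.mul (by fun_prop) (hx.mono fun s hs => hs.1)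

lemma IsModeSolution.eqOn {μ : ℝ} (hμ : 0 ≤ μ) {x y : ℝ → ℝ}
    (hx : IsModeSolution (fun t => t) μ x) (hy : IsModeSolution (fun t => t) μ y) :
    EqOn x y (Ici 0) := by
  intro t ht
  refine sub_eq_zero.1 (eq_zero_of_memory_equation (w := fun t => x t - y t) hμ
    (hx.continuousOn.sub hy.continuousOn) (by simp [hx.initial, hy.initial]) ?_ ht)
  intro t ht
  refine ((hx.equation t ht).sub (hy.equation t ht)).congr_deriv ?_
  simp only [mul_sub]
  rw [intervalIntegral.integral_sub (intervalIntegrable_sub_mul hx.continuousOn ht)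
    (intervalIntegrable_sub_mul hy.continuousOn ht)]
  ring

/-- The characteristic polynomial `s³ + μ s² + 1` has one real root `r < 0` and a conjugate pair
`a ± i b` with `a > 0`. The equations are Vieta's relations. -/
lemma exists_characteristic_roots {μ : ℝ} (hμ : 0 ≤ μ) :
    ∃ r a b : ℝ, r < 0 ∧ 0 < a ∧ 0 < b ∧ r + 2 * a = -μ ∧ 2 * a * r + (a ^ 2 + b ^ 2) = 0 ∧
      r * (a ^ 2 + b ^ 2) = -1 := by
  obtain ⟨r, hr, hr0⟩ : ∃ r ∈ Icc (-μ - 1) (-μ), r ^ 3 + μ * r ^ 2 + 1 = 0 := by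
    have h := intermediate_value_Icc (show -μ - 1 ≤ -μ by linarith)
      (f := fun r : ℝ => r ^ 3 + μ * r ^ 2 + 1) (by fun_prop)
    refine h ⟨?_, ?_⟩ <;> nlinarith
  have hrμ : r < -μ := by
    refine lt_of_le_of_ne hr.2 fun h => ?_
    rw [h] at hr0
    nlinarith
  have hq : 0 < r * (r + μ) - ((-μ - r) / 2) ^ 2 := by nlinarith
  have hs := Real.sq_sqrt hq.le
  refine ⟨r, (-μ - r) / 2, Real.sqrt (r * (r + μ) - ((-μ - r) / 2) ^ 2), by linarith, by linarith,
    Real.sqrt_pos.2 hq, by ring, ?_, ?_⟩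
  · rw [hs]; ring
  · rw [hs]; linear_combination hr0

/-- The function `p e^{rt} + e^{at} (q cos bt + s sin bt)`. -/
noncomputable def modeFun (r a b p q s : ℝ) (t : ℝ) : ℝ :=
  p * Real.exp (r * t) + Real.exp (a * t) * (q * Real.cos (b * t) + s * Real.sin (b * t))

lemma hasDerivAt_modeFun (r a b p q s t : ℝ) :
    HasDerivAt (modeFun r a b p q s) (modeFun r a b (r * p) (a * q + b * s) (a * s - b * q) t) t := by
  have hl : ∀ c : ℝ, HasDerivAt (fun t => c * t) c t := fun c => by
    simpa using (hasDerivAt_id t).const_mul c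
  have := ((hl r).exp.const_mul p).add ((hl a).exp.mul
    (((hl b).cos.const_mul q).add ((hl b).sin.const_mul s)))
  refine this.congr_deriv ?_
  simp only [modeFun, Pi.add_apply]
  ring

lemma continuous_modeFun (r a b p q s : ℝ) : Continuous (modeFun r a b p q s) := by
  unfold modeFun; fun_prop

/-- An explicit solution of the mode equation: the second derivative of the solution of
`u''' + μ u'' + u = 0` with `u(0) = u'(0) = 0` and `u''(0) = 1`. -/
lemma exists_isModeSolution_modeFun {μ : ℝ} (hμ : 0 ≤ μ) :
    ∃ r a b p q s : ℝ, r < a ∧ 0 < p ∧ IsModeSolution (fun t => t) μ (modeFun r a b p q s) := by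
  obtain ⟨r, a, b, hr, ha, hb, h1, h2, h3⟩ := exists_characteristic_roots hμ
  have hd : 0 < (r - a) ^ 2 + b ^ 2 := by positivity
  -- `p₀` is the residue of the real exponential, `s₀` enforces `u'(0) = 0`
  set p₀ : ℝ := ((r - a) ^ 2 + b ^ 2)⁻¹ with hp₀
  have hp₀d : p₀ * ((r - a) ^ 2 + b ^ 2) = 1 := inv_mul_cancel₀ hd.ne'
  set s₀ : ℝ := p₀ * (a - r) / b with hs₀
  have hs₀b : s₀ * b = p₀ * (a - r) := div_mul_cancel₀ _ hb.ne'
  have d0 := hasDerivAt_modeFun r a b p₀ (-p₀) s₀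
  have d1 := hasDerivAt_modeFun r a b (r * p₀) (a * (-p₀) + b * s₀) (a * s₀ - b * (-p₀))
  have d2 := hasDerivAt_modeFun r a b (r * (r * p₀))
    (a * (a * (-p₀) + b * s₀) + b * (a * s₀ - b * (-p₀)))
    (a * (a * s₀ - b * (-p₀)) - b * (a * (-p₀) + b * s₀))
  have e1 : r ^ 3 + μ * r ^ 2 + 1 = 0 := by linear_combination r ^ 2 * h1 - r * h2 + h3
  refine ⟨r, a, b, r * (r * p₀), a * (a * (-p₀) + b * s₀) + b * (a * s₀ - b * (-p₀)),
    a * (a * s₀ - b * (-p₀)) - b * (a * (-p₀) + b * s₀), by linarith, ?_,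
    (continuous_modeFun _ _ _ _ _ _).continuousOn, ?_, fun t ht => ?_⟩
  · have := mul_pos_of_neg_of_neg hr hr
    rw [← mul_assoc]
    positivity
  · simp only [modeFun, mul_zero, Real.exp_zero, Real.cos_zero, Real.sin_zero]
    linear_combination hp₀d + 2 * a * hs₀b
  · rw [integral_sub_mul_eq d0 d1 (continuous_modeFun _ _ _ _ _ _)]
    · refine (d2 t).congr_deriv ?_
      simp only [modeFun]
      -- the oscillating part is annihilated by `D² - 2 a D + (a² + b²)`
      linear_combination (p₀ * Real.exp (r * t)) * e1 + Real.exp (a * t) *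
        (((a * (a * (-p₀) + b * s₀) + b * (a * s₀ - b * (-p₀))) * Real.cos (b * t) +
          (a * (a * s₀ - b * (-p₀)) - b * (a * (-p₀) + b * s₀)) * Real.sin (b * t)) * h1 -
        ((a * (-p₀) + b * s₀) * Real.cos (b * t) + (a * s₀ - b * (-p₀)) * Real.sin (b * t)) * h2 +
        (-p₀ * Real.cos (b * t) + s₀ * Real.sin (b * t)) * h3)
    · simp [modeFun]
    · simp only [modeFun, mul_zero, Real.exp_zero, Real.cos_zero, Real.sin_zero]
      linear_combination hs₀b

/-- A linear combination of a cosine and a sine is a shifted sine. -/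
lemma exists_mul_cos_add_mul_sin_eq (q s : ℝ) :
    ∃ C φ : ℝ, ∀ θ : ℝ, q * Real.cos θ + s * Real.sin θ = C * Real.sin (θ + φ) := by
  refine ⟨‖(⟨s, q⟩ : ℂ)‖, Complex.arg ⟨s, q⟩, fun θ => ?_⟩
  have h1 := Complex.norm_mul_cos_arg ⟨s, q⟩
  have h2 := Complex.norm_mul_sin_arg ⟨s, q⟩
  simp only at h1 h2
  rw [Real.sin_add]
  linear_combination (-Real.cos θ) * h2 - Real.sin θ * h1

/-- Dividing the explicit mode by `e^{at}` separates the decaying exponential from a pure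
oscillation. -/
lemma zeroSet_eq {μ : ℝ} (hμ : 0 ≤ μ) : ∃ α C β φ : ℝ, α < 0 ∧
    zeroSet (fun t : ℝ => t) μ = {t : ℝ | 0 < t ∧ Real.exp (α * t) = C * Real.sin (β * t + φ)} := by
  obtain ⟨r, a, b, p, q, s, hra, hp, hx⟩ := exists_isModeSolution_modeFun hμ
  obtain ⟨C, φ, hC⟩ := exists_mul_cos_add_mul_sin_eq (-q / p) (-s / p)
  refine ⟨r - a, C, b, φ, by linarith, ?_⟩
  ext t
  refine and_congr_right fun ht => ?_
  have h1 : (∃ x : ℝ → ℝ, IsModeSolution (fun t => t) μ x ∧ x t = 0) ↔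
      modeFun r a b p q s t = 0 :=
    ⟨fun ⟨x, hx', h⟩ => hx.eqOn hμ hx' ht.le ▸ h, fun h => ⟨_, hx, h⟩⟩
  have h2 : Real.exp (r * t) = Real.exp (a * t) * Real.exp ((r - a) * t) := by
    rw [← Real.exp_add]; ring_nf
  have h3 : modeFun r a b p q s t = p * Real.exp (a * t) *
      (Real.exp ((r - a) * t) - C * Real.sin (b * t + φ)) := by
    rw [← hC, modeFun, h2]
    field_simp
    ring
  rw [h1, h3, mul_eq_zero, or_iff_right (by positivity), sub_eq_zero]

/-- An exponential `e^{αt}` with `α < 0` is unbounded, so it meets a sine only at the zeros of an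
analytic function that does not vanish identically. -/
lemma countable_setOf_exp_eq_sin {α : ℝ} (hα : α < 0) (C β φ : ℝ) :
    {t : ℝ | Real.exp (α * t) = C * Real.sin (β * t + φ)}.Countable := by
  have hf : AnalyticOnNhd ℝ (fun t => Real.exp (α * t) - C * Real.sin (β * t + φ)) univ := by
    intro t _
    fun_prop
  have hx : Real.exp (α * (|C| / α)) - C * Real.sin (β * (|C| / α) + φ) ≠ 0 := by
    rw [mul_div_cancel₀ _ hα.ne]
    have h1 := Real.add_one_le_exp |C|
    have h2 : C * Real.sin (β * (|C| / α) + φ) ≤ |C| := by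
      refine (le_abs_self _).trans ?_
      rw [abs_mul]
      exact mul_le_of_le_one_right (abs_nonneg _) (Real.abs_sin_le_one _)
    linarith
  have h := hf.preimage_zero_mem_codiscreteWithin hx (mem_univ _) isConnected_univ
  rw [mem_codiscreteWithin_iff_forall_mem_nhdsNE] at h
  -- around each point the set has at most one element; countably many such neighborhoods cover `ℝ`
  have h2 : ∀ x : ℝ, {t | t = x ∨ Real.exp (α * t) ≠ C * Real.sin (β * t + φ)} ∈ nhds x := by
    intro x
    have h3 := mem_nhdsWithin_iff_eventually.1 (h x (mem_univ x))
    filter_upwards [h3] with t ht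
    by_cases htx : t = x
    · exact Or.inl htx
    · simpa [sub_eq_zero, htx] using ht htx
  obtain ⟨s, hs, hsu⟩ := TopologicalSpace.countable_cover_nhds h2
  refine hs.mono fun t ht => ?_
  obtain ⟨x, hx, htx⟩ := mem_iUnion₂.1 (hsu.symm ▸ mem_univ t : t ∈ ⋃ x ∈ s, _)
  rcases htx with rfl | h3
  · exact hx
  · exact absurd ht h3

/-! ### Mollification estimates -/

lemma sq_lintegral_le {α : Type*} [MeasurableSpace α] (ν : Measure α) {f : α → ENNReal}
    (hf : AEMeasurable f ν) : (∫⁻ x, f x ∂ν) ^ 2 ≤ ν univ * ∫⁻ x, f x ^ 2 ∂ν := by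
  have h := ENNReal.lintegral_mul_le_Lp_mul_Lq ν (Real.HolderConjugate.two_two) hf
    (g := fun _ => 1) aemeasurable_const
  simp only [Pi.mul_apply, mul_one, lintegral_const, one_pow, one_mul,
    ENNReal.rpow_two] at h
  calc (∫⁻ x, f x ∂ν) ^ 2 ≤ ((∫⁻ x, f x ^ 2 ∂ν) ^ (1 / 2 : ℝ) * ν univ ^ (1 / 2 : ℝ)) ^ 2 := by
        gcongr
    _ = ν univ * ∫⁻ x, f x ^ 2 ∂ν := by
        rw [mul_pow, ← ENNReal.rpow_mul_natCast, ← ENNReal.rpow_mul_natCast, mul_comm]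
        norm_num

/-- The fundamental theorem of calculus along the segment from `x` to `x - z`, with the
Cauchy-Schwarz inequality. -/
lemma enorm_sub_translate_sq_le {n : ℕ} {φ : Space n → ℝ} (hφ : ContDiff ℝ 1 φ) (x z : Space n) :
    ‖φ (x - z) - φ x‖ₑ ^ 2 ≤
      ‖z‖ₑ ^ 2 * ∫⁻ s in Ioc (0 : ℝ) 1, ‖fderiv ℝ φ (x - s • z)‖ₑ ^ 2 := by
  have hc : Continuous fun s : ℝ => fderiv ℝ φ (x - s • z) :=
    (hφ.continuous_fderiv one_ne_zero).comp (by fun_prop)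
  have hd : ∀ s ∈ uIcc (0 : ℝ) 1,
      HasDerivAt (fun s : ℝ => φ (x - s • z)) (fderiv ℝ φ (x - s • z) (-z)) s := by
    intro s _
    have h1 : HasDerivAt (fun s : ℝ => x - s • z) (-z) s := by
      simpa using ((hasDerivAt_id s).smul_const z).const_sub x
    exact ((hφ.differentiable one_ne_zero) _).hasFDerivAt.comp_hasDerivAt s h1
  have h := intervalIntegral.integral_eq_sub_of_hasDerivAt hd
    (Continuous.intervalIntegrable (by fun_prop) _ _)
  rw [intervalIntegral.integral_of_le zero_le_one] at h
  simp only [one_smul, zero_smul, sub_zero] at h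
  have hm : Measurable fun s : ℝ => ‖fderiv ℝ φ (x - s • z)‖ₑ := hc.enorm.measurable
  calc ‖φ (x - z) - φ x‖ₑ ^ 2
      ≤ (∫⁻ s in Ioc (0 : ℝ) 1, ‖z‖ₑ * ‖fderiv ℝ φ (x - s • z)‖ₑ) ^ 2 := by
        rw [← h]
        gcongr
        refine (enorm_integral_le_lintegral_enorm _).trans (lintegral_mono fun s => ?_)
        refine (ContinuousLinearMap.le_opENorm _ _).trans ?_
        rw [enorm_neg, mul_comm]
    _ ≤ ‖z‖ₑ ^ 2 * ∫⁻ s in Ioc (0 : ℝ) 1, ‖fderiv ℝ φ (x - s • z)‖ₑ ^ 2 := by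
        rw [lintegral_const_mul _ hm, mul_pow]
        gcongr
        simpa using sq_lintegral_le (volume.restrict (Ioc (0 : ℝ) 1)) hm.aemeasurable

lemma lintegral_sub_translate_sq_le {n : ℕ} {φ : Space n → ℝ} (hφ : ContDiff ℝ 1 φ)
    (z : Space n) :
    ∫⁻ x, ‖φ (x - z) - φ x‖ₑ ^ 2 ≤ ‖z‖ₑ ^ 2 * ∫⁻ x, ‖fderiv ℝ φ x‖ₑ ^ 2 := by
  have hc := hφ.continuous_fderiv one_ne_zero
  have hc' : Continuous fun p : Space n × ℝ => ‖fderiv ℝ φ (p.1 - p.2 • z)‖ₑ ^ 2 :=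
    (ENNReal.continuous_pow 2).comp (hc.comp (by fun_prop)).enorm
  calc ∫⁻ x, ‖φ (x - z) - φ x‖ₑ ^ 2
      ≤ ∫⁻ x, ‖z‖ₑ ^ 2 * ∫⁻ s in Ioc (0 : ℝ) 1, ‖fderiv ℝ φ (x - s • z)‖ₑ ^ 2 :=
        lintegral_mono fun x => enorm_sub_translate_sq_le hφ x z
    _ = ‖z‖ₑ ^ 2 * ∫⁻ s in Ioc (0 : ℝ) 1, ∫⁻ x, ‖fderiv ℝ φ (x - s • z)‖ₑ ^ 2 := by
        rw [lintegral_const_mul' _ _ (by simp), lintegral_lintegral_swap hc'.aemeasurable]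
    _ = ‖z‖ₑ ^ 2 * ∫⁻ x, ‖fderiv ℝ φ x‖ₑ ^ 2 := by
        simp only [lintegral_sub_right_eq_self (μ := (volume : Measure (Space n)))
          (fun x => ‖fderiv ℝ φ x‖ₑ ^ 2)]
        simp

/-- Averaging the translates of `φ` over a ball of radius `ε` moves `φ` by at most `ε` times its
Dirichlet norm. -/
lemma lintegral_average_translate_sq_le {n : ℕ} {φ : Space n → ℝ} (hφ : ContDiff ℝ 1 φ)
    (ν : Measure (Space n)) [IsFiniteMeasure ν] {ε : ENNReal} (hν : ∀ᵐ z ∂ν, ‖z‖ₑ ≤ ε) :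
    ∫⁻ x, ‖∫ z, (φ (x - z) - φ x) ∂ν‖ₑ ^ 2 ≤
      (ν univ * ε) ^ 2 * ∫⁻ x, ‖fderiv ℝ φ x‖ₑ ^ 2 := by
  have hc : Continuous fun p : Space n × Space n => ‖φ (p.1 - p.2) - φ p.1‖ₑ :=
    Continuous.enorm (by have := hφ.continuous; fun_prop)
  have hc2 : Continuous fun p : Space n × Space n => ‖φ (p.1 - p.2) - φ p.1‖ₑ ^ 2 :=
    (ENNReal.continuous_pow 2).comp hc
  calc ∫⁻ x, ‖∫ z, (φ (x - z) - φ x) ∂ν‖ₑ ^ 2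
      ≤ ∫⁻ x, ν univ * ∫⁻ z, ‖φ (x - z) - φ x‖ₑ ^ 2 ∂ν := by
        refine lintegral_mono fun x => ?_
        refine le_trans (by gcongr; exact enorm_integral_le_lintegral_enorm _)
          (sq_lintegral_le ν ?_)
        exact (hc.comp (Continuous.prodMk_right x)).measurable.aemeasurable
    _ = ν univ * ∫⁻ z, (∫⁻ x, ‖φ (x - z) - φ x‖ₑ ^ 2) ∂ν := by
        rw [lintegral_const_mul' _ _ (measure_ne_top _ _),
          lintegral_lintegral_swap hc2.aemeasurable]
    _ ≤ ν univ * ∫⁻ _, (ε ^ 2 * ∫⁻ x, ‖fderiv ℝ φ x‖ₑ ^ 2) ∂ν := by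
        gcongr ν univ * ?_
        refine lintegral_mono_ae ?_
        filter_upwards [hν] with z hz
        exact (lintegral_sub_translate_sq_le hφ z).trans (by gcongr)
    _ = (ν univ * ε) ^ 2 * ∫⁻ x, ‖fderiv ℝ φ x‖ₑ ^ 2 := by
        rw [lintegral_const]; ring

/-! ### Integral operators with square integrable kernels -/

section KernelOperator

variable {α H : Type*} [MeasurableSpace α] (μ : Measure α) [NormedAddCommGroup H]
  [InnerProductSpace ℝ H]

/-- The operator `H → L²(μ)` with kernel `k ∈ L²(μ; H)`: it maps `u` to `x ↦ ⟪u, k x⟫`. -/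
noncomputable def kernelOp : Lp H 2 μ →L[ℝ] H →L[ℝ] Lp ℝ 2 μ :=
  (ContinuousLinearMap.compLpL₂ 2 μ (innerSL ℝ : H →L[ℝ] H →L[ℝ] ℝ)).flip

lemma coeFn_kernelOp (k : Lp H 2 μ) (u : H) :
    kernelOp μ k u =ᵐ[μ] fun x => inner ℝ u (k x) :=
  ContinuousLinearMap.coeFn_compLp (innerSL ℝ u) k

/-- Simple kernels give operators of finite rank, and they are dense in `L²(μ; H)`. -/
lemma isCompactOperator_kernelOp (k : Lp H 2 μ) : IsCompactOperator (kernelOp μ k) := by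
  refine Lp.induction (p := 2) (by simp) (fun k : Lp H 2 μ => IsCompactOperator (kernelOp μ k))
    (fun c t hs hμs => ?_) (fun f g hf hg _ hf' hg' => ?_) ?_ k
  · have h : kernelOp μ (Lp.simpleFunc.indicatorConst 2 hs hμs.ne c : Lp H 2 μ) =
        (ContinuousLinearMap.toSpanSingleton ℝ (indicatorConstLp 2 hs hμs.ne (1 : ℝ))).comp
          (innerSL ℝ c) := by
      ext1 u
      rw [Lp.simpleFunc.coe_indicatorConst]
      apply Lp.ext
      simp only [ContinuousLinearMap.comp_apply, ContinuousLinearMap.toSpanSingleton_apply,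
        innerSL_apply_apply]
      filter_upwards [coeFn_kernelOp μ (indicatorConstLp 2 hs hμs.ne c) u,
        Lp.coeFn_smul (inner ℝ c u) (indicatorConstLp 2 hs hμs.ne (1 : ℝ)),
        indicatorConstLp_coeFn (p := 2) (hs := hs) (hμs := hμs.ne) (c := c),
        indicatorConstLp_coeFn (p := 2) (hs := hs) (hμs := hμs.ne) (c := (1 : ℝ))]
        with x h1 h2 h3 h4
      rw [h1, h2, h3, Pi.smul_apply, h4]
      by_cases hx : x ∈ t
      · simp [indicator_of_mem hx, real_inner_comm]
      · simp [indicator_of_notMem hx]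
    rw [h]
    exact (isCompactOperator_of_locallyCompactSpace_dom (innerSL ℝ c)).clm_comp
      (ContinuousLinearMap.toSpanSingleton ℝ (indicatorConstLp 2 hs hμs.ne (1 : ℝ)))
  · rw [map_add]
    exact hf'.add hg'
  · exact (isClosed_setOfPred_isCompactOperator (σ₁₂ := RingHom.id ℝ) (M₁ := H)
      (M₂ := Lp ℝ 2 μ)).preimage (kernelOp μ).continuous

end KernelOperator

/-! ### Compactness of the embedding of `H¹₀(Ω)` -/

/-- The tent function `z ↦ max (ε - |z|) 0`. -/
noncomputable def tent {n : ℕ} (ε : ℝ) (z : Space n) : ℝ := max (ε - ‖z‖) 0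

section Tent

variable {n : ℕ} {ε : ℝ}

lemma tent_nonneg (z : Space n) : 0 ≤ tent ε z := le_max_right _ _

lemma continuous_tent : Continuous (tent ε : Space n → ℝ) := by unfold tent; fun_prop

lemma abs_tent_sub_le (z w : Space n) : |tent ε z - tent ε w| ≤ ‖z - w‖ := by
  refine (abs_max_sub_max_le_abs _ _ _).trans ?_
  rw [sub_sub_sub_cancel_left, abs_sub_comm]
  exact abs_norm_sub_norm_le _ _

lemma norm_tent_le (hε : 0 ≤ ε) (z : Space n) : ‖tent ε z‖ ≤ ε := by
  rw [Real.norm_of_nonneg (tent_nonneg z)]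
  exact max_le (by linarith [norm_nonneg z]) hε

lemma tent_eq_zero {z : Space n} (hz : ε ≤ ‖z‖) : tent ε z = 0 := max_eq_right (by linarith)

lemma hasCompactSupport_tent : HasCompactSupport (tent ε : Space n → ℝ) := by
  refine HasCompactSupport.of_support_subset_isCompact (isCompact_closedBall 0 ε) fun z hz => ?_
  by_contra h
  rw [mem_closedBall_zero_iff, not_le] at h
  exact hz (tent_eq_zero h.le)

lemma integral_tent_pos (hε : 0 < ε) : 0 < ∫ z : Space n, tent ε z :=
  continuous_tent.integral_pos_of_hasCompactSupport_nonneg_nonzero hasCompactSupport_tent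
    tent_nonneg (x := 0) (by simp [tent, hε.ne', hε.le])

end Tent

lemma enorm_sq_eq_lintegral {α E : Type*} [NormedAddCommGroup E] [MeasurableSpace α]
    {μ : Measure α} (f : Lp E 2 μ) : ‖f‖ₑ ^ 2 = ∫⁻ x, ‖f x‖ₑ ^ 2 ∂μ := by
  have := eLpNorm_nnreal_pow_eq_lintegral (μ := μ) (f := f) (p := 2) two_ne_zero
  simpa [Lp.enorm_def] using this

section Mollifier

variable {n : ℕ} (Ω : Set (Space n)) [IsFiniteMeasure (volume.restrict Ω)]

/-- The bounded continuous function `y ↦ tent ε (x - y)`. -/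
noncomputable def tentAt {ε : ℝ} (hε : 0 ≤ ε) (x : Space n) :
    BoundedContinuousFunction (Space n) ℝ :=
  BoundedContinuousFunction.ofNormedAddCommGroup (fun y => tent ε (x - y))
    (continuous_tent.comp (by fun_prop)) ε fun y => norm_tent_le hε _

lemma continuous_tentAt {ε : ℝ} (hε : 0 ≤ ε) :
    Continuous (tentAt hε : Space n → BoundedContinuousFunction (Space n) ℝ) := by
  refine (LipschitzWith.of_dist_le_mul (K := 1) fun x x' => ?_).continuous
  rw [BoundedContinuousFunction.dist_le (by positivity)]
  intro y
  refine (abs_tent_sub_le _ _).trans ?_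
  simp [dist_eq_norm]

/-- The convolution kernel `x ↦ tent ε (x - ·)`, as an element of `L²(Ω; L²(Ω))`. -/
lemma memLp_tentAt {ε : ℝ} (hε : 0 ≤ ε) :
    MemLp (fun x => BoundedContinuousFunction.toLp 2 (volume.restrict Ω) ℝ (tentAt hε x) :
      Space n → L2 Ω) 2 (volume.restrict Ω) := by
  have hc : Continuous (fun x => BoundedContinuousFunction.toLp 2 (volume.restrict Ω) ℝ
      (tentAt hε x) : Space n → L2 Ω) :=
    (BoundedContinuousFunction.toLp 2 (volume.restrict Ω) ℝ).continuous.comp (continuous_tentAt hε)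
  refine MemLp.of_bound hc.aestronglyMeasurable
    (‖(BoundedContinuousFunction.toLp 2 (volume.restrict Ω) ℝ :
      BoundedContinuousFunction (Space n) ℝ →L[ℝ] L2 Ω)‖ * ε) (ae_of_all _ fun x => ?_)
  refine (ContinuousLinearMap.le_opNorm _ _).trans ?_
  gcongr
  exact BoundedContinuousFunction.norm_ofNormedAddCommGroup_le _ hε _

/-- Convolution with the tent function, as an operator on `L²(Ω)`. -/
noncomputable def tentOp {ε : ℝ} (hε : 0 ≤ ε) : L2 Ω →L[ℝ] L2 Ω :=
  kernelOp (volume.restrict Ω) (memLp_tentAt Ω hε).toLp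

lemma isCompactOperator_tentOp {ε : ℝ} (hε : 0 ≤ ε) : IsCompactOperator (tentOp Ω hε) :=
  isCompactOperator_kernelOp _ _

lemma coeFn_tentOp {ε : ℝ} (hε : 0 ≤ ε) {u : L2 Ω} {φ : Space n → ℝ} (hφ : tsupport φ ⊆ Ω)
    (hu : u =ᵐ[volume.restrict Ω] φ) :
    tentOp Ω hε u =ᵐ[volume.restrict Ω] fun x => ∫ z, tent ε z * φ (x - z) := by
  filter_upwards [coeFn_kernelOp (volume.restrict Ω) (memLp_tentAt Ω hε).toLp u,
    (memLp_tentAt Ω hε).coeFn_toLp] with x h1 h2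
  rw [tentOp, h1, h2, L2.inner_def]
  have h3 : (fun y => inner ℝ (u y)
      (BoundedContinuousFunction.toLp 2 (volume.restrict Ω) ℝ (tentAt hε x) y))
      =ᵐ[volume.restrict Ω] fun y => tent ε (x - y) * φ y := by
    filter_upwards [hu, BoundedContinuousFunction.coeFn_toLp 2 (volume.restrict Ω) ℝ
      (tentAt hε x)] with y h4 h5
    rw [h4, h5]
    rfl
  rw [integral_congr_ae h3, setIntegral_eq_integral_of_forall_compl_eq_zero]
  · rw [← integral_sub_left_eq_self _ _ x]
    simp
  · intro y hy
    rw [image_eq_zero_of_notMem_tsupport fun h => hy (hφ h), mul_zero]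

/-- The distance from `φ ∈ C_c^∞(Ω)` to its mollification is controlled by its Dirichlet norm. -/
lemma norm_tentOp_sub_le_of_mem_testGraph {ε : ℝ} (hε : 0 ≤ ε) {p : L2 Ω × L2Field Ω}
    (hp : p ∈ testGraph Ω) :
    ‖tentOp Ω hε p.1 - (∫ z : Space n, tent ε z) • p.1‖ ≤
      (∫ z : Space n, tent ε z) * ε * ‖p.2‖ := by
  obtain ⟨φ, hφ, hφc, hφΩ, h1, h2⟩ := hp
  set c : ℝ := ∫ z : Space n, tent ε z
  have hc0 : 0 ≤ c := integral_nonneg tent_nonneg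
  have hti : Integrable (tent ε : Space n → ℝ) :=
    continuous_tent.integrable_of_hasCompactSupport hasCompactSupport_tent
  -- convolution with the tent function averages translates over this measure
  let ν : Measure (Space n) := volume.withDensity fun z => ENNReal.ofReal (tent ε z)
  have hνu : ν univ = ENNReal.ofReal c := by
    rw [withDensity_apply _ MeasurableSet.univ, setLIntegral_univ,
      ← ofReal_integral_eq_lintegral_ofReal hti (ae_of_all _ tent_nonneg)]
  have : IsFiniteMeasure ν := ⟨hνu ▸ ENNReal.ofReal_lt_top⟩
  have hm : Measurable fun z : Space n => ENNReal.ofReal (tent ε z) :=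
    continuous_tent.measurable.ennreal_ofReal
  have hν : ∀ᵐ z ∂ν, ‖z‖ₑ ≤ ENNReal.ofReal ε := by
    rw [ae_withDensity_iff hm]
    refine ae_of_all _ fun z hz => ?_
    rw [← ofReal_norm]
    refine ENNReal.ofReal_le_ofReal ?_
    by_contra! h
    exact hz (by rw [tent_eq_zero h.le, ENNReal.ofReal_zero])
  have hφ1 : ContDiff ℝ 1 φ := hφ.of_le (by norm_cast)
  have hmoll : ∀ x, ∫ z, (φ (x - z) - φ x) ∂ν = (∫ z, tent ε z * φ (x - z)) - c * φ x := by
    intro x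
    have hi : Integrable fun z => tent ε z * φ (x - z) := by
      refine Continuous.integrable_of_hasCompactSupport
        (continuous_tent.mul (hφ.continuous.comp (by fun_prop))) hasCompactSupport_tent.mul_right
    rw [integral_withDensity_eq_integral_toReal_smul hm (ae_of_all _ fun _ => ENNReal.ofReal_lt_top)]
    simp only [ENNReal.toReal_ofReal (tent_nonneg _), smul_eq_mul, mul_sub]
    rw [integral_sub hi (hti.mul_const _), integral_mul_const]
  have key := lintegral_average_translate_sq_le hφ1 ν hν
  have hL : ‖tentOp Ω hε p.1 - c • p.1‖ₑ ^ 2 ≤ ∫⁻ x, ‖∫ z, (φ (x - z) - φ x) ∂ν‖ₑ ^ 2 := by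
    rw [enorm_sq_eq_lintegral]
    refine le_trans (le_of_eq (lintegral_congr_ae ?_)) (setLIntegral_le_lintegral Ω _)
    filter_upwards [coeFn_tentOp Ω hε hφΩ h1, h1, Lp.coeFn_sub (tentOp Ω hε p.1) (c • p.1),
      Lp.coeFn_smul c p.1] with x g1 g2 g3 g4
    rw [g3, Pi.sub_apply, g4, Pi.smul_apply, g1, g2, hmoll, smul_eq_mul]
  have hR : ∫⁻ x, ‖fderiv ℝ φ x‖ₑ ^ 2 = ‖p.2‖ₑ ^ 2 := by
    rw [enorm_sq_eq_lintegral, ← setLIntegral_eq_of_support_subset (s := Ω)]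
    · refine lintegral_congr_ae ?_
      filter_upwards [h2] with x g
      rw [g, gradient, LinearIsometryEquiv.enorm_map]
    · intro x hx
      by_contra h
      refine hx ?_
      have h3 : fderiv ℝ φ x = 0 := by
        by_contra h4
        exact h (hφΩ (support_fderiv_subset ℝ h4))
      simp only [← ofReal_norm, h3, norm_zero, ENNReal.ofReal_zero, ne_eq, OfNat.ofNat_ne_zero,
        not_false_eq_true, zero_pow]
  rw [hR, hνu] at key
  have h3 : ‖tentOp Ω hε p.1 - c • p.1‖ₑ ≤ ENNReal.ofReal c * ENNReal.ofReal ε * ‖p.2‖ₑ := by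
    rw [← ENNReal.pow_le_pow_left_iff two_ne_zero, mul_pow]
    exact hL.trans key
  rw [← ofReal_norm, ← ofReal_norm, ← ENNReal.ofReal_mul hc0, ← ENNReal.ofReal_mul (by positivity)]
    at h3
  exact (ENNReal.ofReal_le_ofReal_iff (by positivity)).1 h3

lemma norm_tentOp_sub_le {ε : ℝ} (hε : 0 ≤ ε) {p : L2 Ω × L2Field Ω} (hp : p ∈ H10 Ω) :
    ‖tentOp Ω hε p.1 - (∫ z : Space n, tent ε z) • p.1‖ ≤
      (∫ z : Space n, tent ε z) * ε * ‖p.2‖ := by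
  refine closure_minimal (s := testGraph Ω) (t := {p | ‖tentOp Ω hε p.1 -
    (∫ z : Space n, tent ε z) • p.1‖ ≤ (∫ z : Space n, tent ε z) * ε * ‖p.2‖})
    (fun p hp => norm_tentOp_sub_le_of_mem_testGraph Ω hε hp) (isClosed_le ?_ ?_) hp <;> fun_prop

end Mollifier

/-- The pairs `(φ, ∇φ)` with `φ ∈ C_c^∞(Ω)`, as a linear subspace. -/
noncomputable def testSubmodule {n : ℕ} (Ω : Set (Space n)) : Submodule ℝ (L2 Ω × L2Field Ω) where
  carrier := testGraph Ω
  zero_mem' := by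
    refine ⟨0, contDiff_const, HasCompactSupport.zero, by simp [tsupport], Lp.coeFn_zero _ _ _, ?_⟩
    filter_upwards [Lp.coeFn_zero (Space n) 2 (volume.restrict Ω)] with x hx
    have : gradient (0 : Space n → ℝ) x = 0 := by
      rw [gradient, Pi.zero_def, fderiv_fun_const, Pi.zero_apply, map_zero]
    rw [this]
    exact hx
  add_mem' := by
    rintro p q ⟨φ, hφ, hφc, hφΩ, h1, h2⟩ ⟨ψ, hψ, hψc, hψΩ, h3, h4⟩
    refine ⟨φ + ψ, hφ.add hψ, hφc.add hψc, (tsupport_add φ ψ).trans (union_subset hφΩ hψΩ),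
      (Lp.coeFn_add _ _).trans (h1.add h3), (Lp.coeFn_add _ _).trans ((h2.add h4).trans ?_)⟩
    refine ae_of_all _ fun x => ?_
    rw [Pi.add_apply, gradient, gradient, gradient,
      fderiv_add (hφ.differentiable (by simp) x) (hψ.differentiable (by simp) x), map_add]
  smul_mem' := by
    rintro c p ⟨φ, hφ, hφc, hφΩ, h1, h2⟩
    refine ⟨c • φ, contDiff_const.smul hφ, hφc.smul_left, (tsupport_smul_subset_right (fun _ => c) φ).trans hφΩ,
      (Lp.coeFn_smul _ _).trans (h1.const_smul c),
      (Lp.coeFn_smul _ _).trans ((h2.const_smul c).trans ?_)⟩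
    refine ae_of_all _ fun x => ?_
    rw [Pi.smul_apply, gradient, gradient, fderiv_const_smul (hφ.differentiable (by simp) x)]
    simp

lemma exists_mem_testGraph {n : ℕ} {Ω : Set (Space n)} {φ : Space n → ℝ} (hφ : ContDiff ℝ ∞ φ)
    (hφc : HasCompactSupport φ) (hφΩ : tsupport φ ⊆ Ω) :
    ∃ p ∈ testGraph Ω, p.1 =ᵐ[volume.restrict Ω] φ := by
  have h1 : MemLp φ 2 (volume.restrict Ω) :=
    (hφ.continuous.memLp_of_hasCompactSupport hφc).restrict Ω
  have h2 : MemLp (gradient φ) 2 (volume.restrict Ω) := by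
    refine (Continuous.memLp_of_hasCompactSupport ?_ ?_).restrict Ω
    · exact (InnerProductSpace.toDual ℝ (Space n)).symm.continuous.comp
        (hφ.continuous_fderiv (by simp))
    · exact (hφc.fderiv ℝ).comp_left (map_zero _)
  exact ⟨(h1.toLp, h2.toLp), ⟨φ, hφ, hφc, hφΩ, h1.coeFn_toLp, h2.coeFn_toLp⟩, h1.coeFn_toLp⟩

/-- `H¹₀(Ω)` as a subspace of the Hilbert space `L²(Ω) ⊕ L²(Ω; ℝⁿ)`. -/
noncomputable def H10Submodule {n : ℕ} (Ω : Set (Space n)) : Submodule ℝ (WithLp 2 (L2 Ω × L2Field Ω)) :=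
  (testSubmodule Ω).topologicalClosure.comap
    (WithLp.prodContinuousLinearEquiv 2 ℝ (L2 Ω) (L2Field Ω)).toLinearMap

lemma mem_H10Submodule {n : ℕ} {Ω : Set (Space n)} {w : WithLp 2 (L2 Ω × L2Field Ω)} :
    w ∈ H10Submodule Ω ↔ (w.fst, w.snd) ∈ H10 Ω := Iff.rfl

instance {n : ℕ} (Ω : Set (Space n)) : CompleteSpace (H10Submodule Ω) :=
  IsClosed.completeSpace_coe (hs := (testSubmodule Ω).isClosed_topologicalClosure.preimage
    (WithLp.prodContinuousLinearEquiv 2 ℝ (L2 Ω) (L2Field Ω)).continuous)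

/-- The embedding of `H¹₀(Ω)` into `L²(Ω)`. -/
noncomputable def embed {n : ℕ} (Ω : Set (Space n)) : H10Submodule Ω →L[ℝ] L2 Ω :=
  (WithLp.fstL 2 ℝ (L2 Ω) (L2Field Ω)).comp (H10Submodule Ω).subtypeL

/-- **Rellich's theorem**: mollifications are compact and tend to the embedding in norm. -/
lemma isCompactOperator_embed {n : ℕ} (Ω : Set (Space n)) [IsFiniteMeasure (volume.restrict Ω)] :
    IsCompactOperator (embed Ω) := by
  have hcl : IsClosed {f : H10Submodule Ω →L[ℝ] L2 Ω | IsCompactOperator f} :=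
    isClosed_setOfPred_isCompactOperator
  refine hcl.closure_subset ?_
  refine (Metric.mem_closure_iff (α := H10Submodule Ω →L[ℝ] L2 Ω)).2 fun δ hδ => ?_
  have hε : 0 < δ / 2 := by positivity
  have hc := integral_tent_pos (n := n) hε
  set c : ℝ := ∫ z : Space n, tent (δ / 2) z
  refine ⟨c⁻¹ • (tentOp Ω hε.le).comp (embed Ω),
    ((isCompactOperator_tentOp Ω hε.le).comp_clm (embed Ω)).smul c⁻¹, ?_⟩
  rw [dist_comm]
  refine lt_of_eq_of_lt (dist_eq_norm (E := H10Submodule Ω →L[ℝ] L2 Ω) _ _) ?_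
  refine lt_of_le_of_lt (ContinuousLinearMap.opNorm_le_bound _ hε.le fun w => ?_) (half_lt_self hδ)
  have h1 := norm_tentOp_sub_le Ω hε.le (mem_H10Submodule.1 w.2)
  have h2 : (c⁻¹ • (tentOp Ω hε.le).comp (embed Ω) - embed Ω) w =
      c⁻¹ • (tentOp Ω hε.le (w : WithLp 2 (L2 Ω × L2Field Ω)).fst -
        c • (w : WithLp 2 (L2 Ω × L2Field Ω)).fst) := by
    rw [smul_sub, inv_smul_smul₀ hc.ne']
    rfl
  rw [h2, norm_smul, Real.norm_of_nonneg (inv_nonneg.2 hc.le)]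
  have h3 : ‖(w : WithLp 2 (L2 Ω × L2Field Ω)).snd‖ ≤ ‖w‖ := WithLp.norm_snd_le _ _
  calc c⁻¹ * _ ≤ c⁻¹ * (c * (δ / 2) * ‖(w : WithLp 2 (L2 Ω × L2Field Ω)).snd‖) := by gcongr
    _ = δ / 2 * ‖(w : WithLp 2 (L2 Ω × L2Field Ω)).snd‖ := by field_simp
    _ ≤ δ / 2 * ‖w‖ := by gcongr

/-! ### Eigenvectors of the Dirichlet Laplacian -/

/-- The operator `(1 - A)⁻¹` on `L²(Ω)`, written as `J J*` with `J` the embedding of `H¹₀(Ω)`: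
`J* f` is the pair `(u, ∇u)` for the weak solution `u` of `u - Δ u = f`. -/
noncomputable def resolvent {n : ℕ} (Ω : Set (Space n)) : L2 Ω →L[ℝ] L2 Ω :=
  (embed Ω).comp (ContinuousLinearMap.adjoint (embed Ω))

section Spectrum

variable {n : ℕ} {Ω : Set (Space n)}

/-- The weak equation `u - Δ u = f` for `u = resolvent Ω f`. -/
lemma inner_adjoint_embed (f : L2 Ω) {p : L2 Ω × L2Field Ω} (hp : p ∈ H10 Ω) :
    inner ℝ (resolvent Ω f) p.1 +
      inner ℝ (ContinuousLinearMap.adjoint (embed Ω) f : WithLp 2 (L2 Ω × L2Field Ω)).snd p.2 =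
      inner ℝ f p.1 := by
  have h := ContinuousLinearMap.adjoint_inner_left (embed Ω) ⟨WithLp.toLp 2 p, hp⟩ f
  rw [Submodule.coe_inner, WithLp.prod_inner_apply] at h
  exact h

/-- An eigenvalue `κ ≠ 0` of `(1 - A)⁻¹` gives the eigenvalue `κ⁻¹ - 1` of `-A`. -/
lemma isDirichletLaplacian_of_resolvent_eq {κ : ℝ} (hκ : κ ≠ 0) {u : L2 Ω}
    (hu : resolvent Ω u = κ • u) : IsDirichletLaplacian Ω u (-((κ⁻¹ - 1) • u)) := by
  set w : H10Submodule Ω := ContinuousLinearMap.adjoint (embed Ω) u with hw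
  refine ⟨κ⁻¹ • (w : WithLp 2 (L2 Ω × L2Field Ω)).snd, ?_, fun p hp => ?_⟩
  · have h := (κ⁻¹ • w).2
    rw [mem_H10Submodule] at h
    convert h using 2
    · change u = κ⁻¹ • resolvent Ω u
      rw [hu, inv_smul_smul₀ hκ]
    · rfl
  · have h := inner_adjoint_embed u hp
    rw [hu, real_inner_smul_left] at h
    rw [real_inner_smul_left, inner_neg_left, real_inner_smul_left, ← h, ← hw]
    rw [← eq_sub_iff_add_eq'] at h
    rw [← hw] at h
    rw [h]
    field_simp
    ring

/-- The resolvent is injective because `C_c^∞(Ω)` is dense in `L²(Ω)`. -/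
lemma eq_zero_of_resolvent_eq_zero (hΩ : IsOpen Ω) {u : L2 Ω} (hu : resolvent Ω u = 0) : u = 0 := by
  have hw : ContinuousLinearMap.adjoint (embed Ω) u = 0 := by
    rw [← inner_self_eq_zero (𝕜 := ℝ), ContinuousLinearMap.adjoint_inner_left]
    change inner ℝ u (resolvent Ω u) = 0
    rw [hu, inner_zero_right]
  have h : ∀ᵐ x ∂(volume.restrict Ω), x ∈ Ω → u x = 0 := by
    refine hΩ.ae_eq_zero_of_integral_contDiff_smul_eq_zero ?_ fun φ hφ hφc hφΩ => ?_
    · exact ((Lp.memLp u).locallyIntegrable (by norm_num)).locallyIntegrableOn Ω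
    · obtain ⟨p, hp, hpφ⟩ := exists_mem_testGraph hφ hφc hφΩ
      have h1 := inner_adjoint_embed u (subset_closure hp)
      rw [hu, hw, inner_zero_left, zero_add] at h1
      have h2 : inner ℝ u p.1 = 0 := h1.symm.trans (inner_zero_left _)
      rw [L2.inner_def] at h2
      rw [← h2]
      refine integral_congr_ae ?_
      filter_upwards [hpφ] with x hx
      rw [hx]
      rfl
  rw [Lp.eq_zero_iff_ae_eq_zero]
  filter_upwards [h, ae_restrict_mem hΩ.measurableSet] with x h1 h2 using h1 h2

/-- Completeness of the eigenvectors: the spectral theorem applied to the resolvent. -/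
lemma eq_zero_of_forall_inner_eigenvector_eq_zero (hΩ : IsOpen Ω)
    [IsFiniteMeasure (volume.restrict Ω)] {u : L2 Ω}
    (hu : ∀ (μ : ℝ) (e : L2 Ω), e ≠ 0 → IsDirichletLaplacian Ω e (-(μ • e)) → inner ℝ u e = 0) :
    u = 0 := by
  have hK : IsCompactOperator (resolvent Ω) :=
    (isCompactOperator_embed Ω).comp_clm (ContinuousLinearMap.adjoint (embed Ω))
  have hS : (resolvent Ω).IsSymmetric := by
    refine IsSelfAdjoint.isSymmetric ?_
    rw [ContinuousLinearMap.isSelfAdjoint_iff', resolvent, ContinuousLinearMap.adjoint_comp,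
      ContinuousLinearMap.adjoint_adjoint]
  rw [← Submodule.mem_bot ℝ, ← ContinuousLinearMap.orthogonalComplement_iSup_eigenspaces_eq_bot hK hS]
  have h : (⨆ κ, Module.End.eigenspace (resolvent Ω : Module.End ℝ (L2 Ω)) κ) ≤ (ℝ ∙ u)ᗮ := by
    refine iSup_le fun κ e he => ?_
    rw [Module.End.mem_eigenspace_iff] at he
    rw [Submodule.mem_orthogonal_singleton_iff_inner_right]
    by_cases he0 : e = 0
    · rw [he0, inner_zero_right]
    by_cases hκ : κ = 0
    · exact absurd (eq_zero_of_resolvent_eq_zero hΩ (by simpa [hκ] using he)) he0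
    · exact hu _ e he0 (isDirichletLaplacian_of_resolvent_eq hκ he)
  rw [Submodule.mem_orthogonal]
  intro v hv
  exact (Submodule.mem_orthogonal_singleton_iff_inner_left).1 (h hv)

/-- Testing the weak equation with the eigenvector gives `‖∇e‖² = μ ‖e‖²`. -/
lemma nonneg_of_mem_eigenvalues {μ : ℝ} (hμ : μ ∈ eigenvalues Ω) : 0 ≤ μ := by
  obtain ⟨e, he, G, hG, h⟩ := hμ
  have h1 := h _ hG
  simp only [inner_neg_left, neg_neg, real_inner_smul_left, real_inner_self_eq_norm_sq] at h1
  by_contra! hμ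
  nlinarith [sq_nonneg ‖G‖, pow_pos (norm_pos_iff.2 he) 2]

lemma inner_eq_zero_of_ne {μ ν : ℝ} (hμν : μ ≠ ν) {e f : L2 Ω}
    (he : IsDirichletLaplacian Ω e (-(μ • e))) (hf : IsDirichletLaplacian Ω f (-(ν • f))) :
    inner ℝ e f = 0 := by
  obtain ⟨G, hG, h⟩ := he
  obtain ⟨H, hH, h'⟩ := hf
  have h1 := h _ hH
  have h2 := h' _ hG
  simp only [inner_neg_left, neg_neg, real_inner_smul_left] at h1 h2
  rw [real_inner_comm] at h2
  rw [real_inner_comm e f] at h2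
  have h3 : (μ - ν) * inner ℝ e f = 0 := by linarith
  exact (mul_eq_zero.1 h3).resolve_left (sub_ne_zero.2 hμν)

/-- Unit eigenvectors for distinct eigenvalues have distance `√2`, and `L²(Ω)` is separable. -/
lemma countable_eigenvalues : (eigenvalues Ω).Countable := by
  choose! e he0 he using fun (μ : ℝ) (hμ : μ ∈ eigenvalues Ω) => hμ
  have : Fact ((2 : ENNReal) ≠ ⊤) := ⟨by simp⟩
  refine PairwiseDisjoint.countable_of_isOpen
    (s := fun μ => Metric.ball (‖e μ‖⁻¹ • e μ) (1 / 2)) ?_ (fun _ _ => Metric.isOpen_ball)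
    (fun μ _ => Metric.nonempty_ball.2 (by norm_num))
  intro μ hμ ν hν hμν
  refine Metric.ball_disjoint_ball ?_
  have h1 : ∀ μ ∈ eigenvalues Ω, ‖(‖e μ‖⁻¹ • e μ)‖ = 1 := fun μ hμ => by
    rw [norm_smul, norm_inv, norm_norm, inv_mul_cancel₀ (norm_ne_zero_iff.2 (he0 μ hμ))]
  have h2 : inner ℝ (‖e μ‖⁻¹ • e μ) (‖e ν‖⁻¹ • e ν) = 0 := by
    rw [real_inner_smul_left, real_inner_smul_right,
      inner_eq_zero_of_ne hμν (he μ hμ) (he ν hν), mul_zero, mul_zero]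
  have h3 := norm_sub_sq_real (‖e μ‖⁻¹ • e μ) (‖e ν‖⁻¹ • e ν)
  rw [h2, h1 μ hμ, h1 ν hν] at h3
  rw [dist_eq_norm]
  nlinarith [norm_nonneg (‖e μ‖⁻¹ • e μ - ‖e ν‖⁻¹ • e ν)]

lemma nonempty_eigenvalues (hΩ : IsOpen Ω) (hne : Ω.Nonempty)
    [IsFiniteMeasure (volume.restrict Ω)] : (eigenvalues Ω).Nonempty := by
  by_contra h
  rw [not_nonempty_iff_eq_empty] at h
  have h0 : (memLp_const (1 : ℝ) : MemLp (fun _ => (1 : ℝ)) 2 (volume.restrict Ω)).toLp = 0 :=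
    eq_zero_of_forall_inner_eigenvector_eq_zero hΩ fun μ e he hμ =>
      absurd (h ▸ (⟨e, he, hμ⟩ : μ ∈ eigenvalues Ω)) (notMem_empty μ)
  have h1 : ∀ᵐ x ∂(volume.restrict Ω), False := by
    filter_upwards [(Lp.eq_zero_iff_ae_eq_zero).1 h0, MemLp.coeFn_toLp (memLp_const (1 : ℝ) :
      MemLp (fun _ => (1 : ℝ)) 2 (volume.restrict Ω))] with x h2 h3
    rw [h2] at h3
    simp at h3
  rw [ae_iff] at h1
  simp only [not_false_eq_true, ofPred_true, Measure.restrict_apply_univ] at h1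
  exact (hΩ.measure_pos volume hne).ne' h1

end Spectrum

/-! ### Backward uniqueness -/

/-- The projection of a solution on an eigenvector solves the mode equation, so it can vanish at
`t₀` only if it vanishes initially or `t₀` is a zero of the normalized mode. -/
lemma IsSolution.inner_initial_eq_zero {n : ℕ} {Ω : Set (Space n)} {y₀ : L2 Ω} {y : ℝ → L2 Ω}
    (hy : IsSolution Ω (fun t => t) y₀ y) {t₀ : ℝ} (ht₀ : 0 < t₀) (hyt : y t₀ = 0) {μ : ℝ}
    (hμ : t₀ ∉ zeroSet (fun t => t) μ) {e : L2 Ω} (he : IsDirichletLaplacian Ω e (-(μ • e))) :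
    inner ℝ y₀ e = 0 := by
  by_contra hc
  set c : ℝ := inner ℝ y₀ e
  refine hμ ⟨ht₀, fun t => c⁻¹ * inner ℝ (y t) e, ⟨?_, ?_, fun t ht => ?_⟩, ?_⟩
  · exact continuousOn_const.mul (hy.continuousOn.inner continuousOn_const)
  · rw [hy.initial]
    exact inv_mul_cancel₀ hc
  · refine ((hy.equation e _ he t ht).const_mul c⁻¹).congr_deriv ?_
    have hi : IntervalIntegrable (fun s => (t - s) • y s) volume 0 t := by
      refine ContinuousOn.intervalIntegrable ?_
      rw [uIcc_of_le ht.le]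
      exact ContinuousOn.smul (f := fun s => t - s) (by fun_prop)
        (hy.continuousOn.mono fun s (hs : s ∈ Icc 0 t) => hs.1)
    have h1 : inner ℝ (∫ s in (0 : ℝ)..t, (t - s) • y s) e =
        ∫ s in (0 : ℝ)..t, (t - s) * inner ℝ (y s) e := by
      have h2 := (innerSL ℝ e).intervalIntegral_comp_comm hi
      simp only [innerSL_apply_apply, real_inner_smul_right] at h2
      simp only [real_inner_comm e]
      exact h2.symm
    have h3 : ∫ s in (0 : ℝ)..t, (t - s) * (c⁻¹ * inner ℝ (y s) e) =
        c⁻¹ * ∫ s in (0 : ℝ)..t, (t - s) * inner ℝ (y s) e := by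
      rw [← intervalIntegral.integral_const_mul]
      refine intervalIntegral.integral_congr fun s _ => ?_
      ring
    rw [h1, h3, inner_neg_right, real_inner_smul_right]
    ring
  · simp [hyt]

end HeatMemory

theorem mainTheorem10 (n : ℕ) (hn : 1 ≤ n) (Ω : Set (HeatMemory.Space n))
    (hΩ : HeatMemory.IsBoundedC2Domain Ω) :
    (∃ lam : ℕ → ℝ, HeatMemory.IsEigenvalueSequence Ω lam) ∧
    ∀ lam : ℕ → ℝ, HeatMemory.IsEigenvalueSequence Ω lam →
      (∀ k : ℕ, ∃ α C β φ : ℝ, α < 0 ∧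
        HeatMemory.zeroSet (fun t : ℝ => t) (lam k) =
          {t : ℝ | 0 < t ∧ Real.exp (α * t) = C * Real.sin (β * t + φ)}) ∧
      (⋃ k : ℕ, HeatMemory.zeroSet (fun t : ℝ => t) (lam k)).Countable ∧
      ∀ t₀ : ℝ, 0 < t₀ → t₀ ∉ (⋃ k : ℕ, HeatMemory.zeroSet (fun t : ℝ => t) (lam k)) →
        HeatMemory.BackwardUniquenessAt Ω (fun t : ℝ => t) {t₀} := by
  have hfin : IsFiniteMeasure (volume.restrict Ω) :=
    isFiniteMeasure_restrict.2 hΩ.isBounded.measure_lt_top.ne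
  refine ⟨?_, fun lam hlam => ?_⟩
  · obtain ⟨lam, h⟩ := HeatMemory.countable_eigenvalues.exists_eq_range
      (HeatMemory.nonempty_eigenvalues hΩ.isOpen hΩ.isConnected.nonempty)
    exact ⟨lam, h.symm⟩
  · have hzero : ∀ k : ℕ, ∃ α C β φ : ℝ, α < 0 ∧
        HeatMemory.zeroSet (fun t : ℝ => t) (lam k) =
          {t : ℝ | 0 < t ∧ Real.exp (α * t) = C * Real.sin (β * t + φ)} := fun k =>
      HeatMemory.zeroSet_eq (HeatMemory.nonneg_of_mem_eigenvalues (hlam ▸ mem_range_self k))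
    refine ⟨hzero, countable_iUnion fun k => ?_, fun t₀ ht₀ htk y₀ y hy hyt => ?_⟩
    · obtain ⟨α, C, β, φ, hα, h⟩ := hzero k
      rw [h]
      exact (HeatMemory.countable_setOf_exp_eq_sin hα C β φ).mono fun t ht => ht.2
    · refine HeatMemory.eq_zero_of_forall_inner_eigenvector_eq_zero hΩ.isOpen fun μ e he hμ => ?_
      obtain ⟨k, rfl⟩ : μ ∈ range lam := hlam ▸ (⟨e, he, hμ⟩ : μ ∈ HeatMemory.eigenvalues Ω)
      exact hy.inner_initial_eq_zero ht₀ (hyt t₀ (Finset.mem_singleton_self t₀))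
        (fun h => htk (mem_iUnion.2 ⟨k, h⟩)) hμ
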